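/- Let $\mathcal H$ be a reproducing kernel Hilbert space of complex-valued functions on a set $X$ with reproducing kernel $k$. Let $\mathrm{Mult}(\mathcal H)=\{\varphi:X\to\mathbb C:\ \varphi f\in\mathcal H \text{ for all } f\in\mathcal H\}$ be its multiplier algebra, with norm $\|\varphi\|=\|M_\varphi\|$, where $M_\varphi f=\varphi f$ (a bounded operator on $\mathcal H$ by the closed graph theorem), and with the weak-$*$ topology that it inherits, via $\varphi\mapsto M_\varphi$, from $B(\mathcal H)$ as the dual space of the trace class operators. Suppose that $\mathcal H$ is a complete Pick space, i.e. for all $r,n\in\mathbb N$, $z_1,\dots,z_n\in X$ and $W_1,\dots,W_n\in M_r(\mathbb C)$, if the block matrix $\big[k(z_i,z_j)(I-W_iW_j^*)\big]_{i,j=1}^n$ is positive semidefinite, then there is $\Phi\in M_r(\mathrm{Mult}(\mathcal H))$ of norm at most $1$ (as an operator on $\mathcal H\otimes\mathbb C^r$) with $\Phi(z_i)=W_i$ for $i=1,\dots,n$. Suppose also that $k$ is normalized at $x_0\in X$, i.e. $k(x,x_0)=1$ for all $x\in X$ (so that $1\in\mathcal H$ and $\mathrm{Mult}(\mathcal H)\subset\mathcal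 H$). A bounded linear functional $\tau\neq0$ on $\mathcal H$ is called partially multiplicative if $\tau(fg)=\tau(f)\tau(g)$ whenever $f,g\in\mathcal H$ and $fg\in\mathcal H$. The set $X$ is a maximal domain for $\mathcal H$ if every bounded partially multiplicative functional on $\mathcal H$ is of the form $f\mapsto f(x)$ for some $x\in X$. A character on $\mathrm{Mult}(\mathcal H)$ is a nonzero multiplicative linear functional; for $x \in X$, let $\delta_x$ denote the character $\varphi\mapsto\varphi(x)$. The Gleason part of a character $\rho$ is the set of all characters $\sigma$ with $\|\sigma-\rho\|<2$, the norm being that of functionals on $\mathrm{Mult}(\mathcal H)$. For every character $\rho$ on $\mathrm{Mult}(\mathcal H)$, the following are equivalent: (i) $\rho$ extends to a bounded partially multiplicative functional on $\mathcal H$; (ii) $\rho$ is weak-$*$ continuous; (iii) $\rho$ belongs to the Gleason part of $\delta_{x_0}$. Moreover, the following are equivalent: (i') $X$ is a maximal domain for $\mathcal H$; (ii') every weak-$*$ continuous character on $\mathrm{Mult}(\mathcal H)$ is equal to $\delta_x$ for some $x\in X$; (iii') the set $\{\delta_x : x\in X\}$ is a Gleason part, i.e. it is the Gleason part of some character on $\mathrm{Mult}(\mathcal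 H)$. -/

import Mathlib

open scoped ComplexOrder ENNReal

noncomputable section

namespace PickSpace

section Defs

variable {X : Type*} (H : Type*) [NormedAddCommGroup H] [InnerProductSpace ℂ H]
  [RKHS ℂ H X ℂ]

/-- The multiplier algebra `Mult(H)`: all functions `φ : X → ℂ` such that `φ f ∈ H` for every
`f ∈ H`. -/
def Mult : Subalgebra ℂ (X → ℂ) where
  carrier := {φ | ∀ f : H, ∃ g : H, ∀ x, g x = φ x * f x}
  mul_mem' := by
    intro φ ψ hφ hψ f
    obtain ⟨g, hg⟩ := hψ f
    obtain ⟨h, hh⟩ := hφ g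
    exact ⟨h, fun x => by rw [hh, hg, Pi.mul_apply, mul_assoc]⟩
  add_mem' := by
    intro φ ψ hφ hψ f
    obtain ⟨g, hg⟩ := hφ f
    obtain ⟨h, hh⟩ := hψ f
    exact ⟨g + h, fun x => by
      rw [RKHS.coe_add, Pi.add_apply, Pi.add_apply, hg, hh, add_mul]⟩
  algebraMap_mem' := by
    intro c f
    exact ⟨c • f, fun x => by simp⟩

variable {H}

/-- The function `φ f`, as an element of `H`. -/
def mulFun (φ : Mult H) (f : H) : H := (φ.2 f).choose

theorem mulFun_apply (φ : Mult H) (f : H) (x : X) :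
    mulFun φ f x = (φ : X → ℂ) x * f x := (φ.2 f).choose_spec x

/-- Multiplication by `φ`, as a linear map. -/
def mulLin (φ : Mult H) : H →ₗ[ℂ] H where
  toFun := mulFun φ
  map_add' f g := by
    ext x
    simp [mulFun_apply, mul_add]
  map_smul' c f := by
    ext x
    simp [mulFun_apply]
    ring

variable [CompleteSpace H]

/-- The multiplication operator `M_φ : H → H`, `f ↦ φ f`, which is bounded by the closed graph
theorem. -/
def mulOp (φ : Mult H) : H →L[ℂ] H :=
  ContinuousLinearMap.ofSeqClosedGraph (g := mulLin φ) (by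
    intro u f g hu hgu
    ext x
    have h1 := ((RKHS.continuous_eval (H := H) x).tendsto g).comp hgu
    have h2 := (((RKHS.continuous_eval (H := H) x).tendsto f).comp hu).const_mul ((φ : X → ℂ) x)
    refine tendsto_nhds_unique h1 ?_
    have h3 : mulLin φ f x = (φ : X → ℂ) x * f x := mulFun_apply φ f x
    rw [h3]
    exact h2.congr fun n => (mulFun_apply φ (u n) x).symm)

theorem mulOp_apply (φ : Mult H) (f : H) (x : X) :
    mulOp φ f x = (φ : X → ℂ) x * f x := mulFun_apply φ f x

variable (H)

/-- The scalar reproducing kernel `k(z, w) = ⟨k_w, k_z⟩`, where `f(w) = ⟨f, k_w⟩`. -/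
def ker (z w : X) : ℂ := RKHS.kernel H z w 1

/-- The kernel is normalized at `x₀`: `k(x, x₀) = 1` for all `x`. -/
def IsNormalizedAt (x₀ : X) : Prop := ∀ x : X, ker H x x₀ = 1

variable {H}

/-- A matrix `Φ` of multipliers has norm at most `1`, i.e. it acts (by matrix multiplication) as a
contraction on the Hilbert space direct sum of `r` copies of `H`. -/
def IsContractive {r : ℕ} (Φ : Matrix (Fin r) (Fin r) (Mult H)) : Prop :=
  ∀ f : Fin r → H, ∑ a, ‖∑ b, mulOp (Φ a b) (f b)‖ ^ 2 ≤ ∑ b, ‖f b‖ ^ 2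

variable (H)

/-- Complete Pick spaces: for all `r`, all points `z₁, …, zₙ` and all complex `r × r` matrices
`W₁, …, Wₙ`, if the `nr × nr` block matrix `[k(zᵢ, zⱼ) (I - Wᵢ Wⱼ^*)]` is positive semidefinite,
then some `Φ ∈ M_r(Mult(H))` of norm at most `1` satisfies `Φ(zᵢ) = Wᵢ` for all `i`. -/
def IsCompletePick : Prop :=
  ∀ (r n : ℕ) (z : Fin n → X) (W : Fin n → Matrix (Fin r) (Fin r) ℂ),
    (Matrix.of fun p q : Fin n × Fin r =>
      ker H (z p.1) (z q.1) * (1 - W p.1 * (W q.1).conjTranspose) p.2 q.2).PosSemidef →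
    ∃ Φ : Matrix (Fin r) (Fin r) (Mult H), IsContractive Φ ∧
      ∀ i a b, (Φ a b : X → ℂ) (z i) = W i a b

/-- Characters of `Mult(H)`, i.e. the points of its maximal ideal space: multiplicative linear
functionals with `ρ(1) = 1` (equivalently, nonzero multiplicative linear functionals). -/
abbrev Character : Type _ := Mult H →ₐ[ℂ] ℂ

/-- The character `δ_x` of evaluation at `x`. -/
def evalChar (x : X) : Character H := (Pi.evalAlgHom ℂ (fun _ : X => ℂ) x).comp (Mult H).val

variable {H}

/-- The norm `‖ρ₁ - ρ₂‖` of a difference of characters as a functional on `Mult(H)`, the latter with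
the norm `‖φ‖ = ‖M_φ‖`. -/
def charDist (ρ₁ ρ₂ : Character H) : ℝ≥0∞ :=
  ⨆ (φ : Mult H) (_ : ‖mulOp φ‖ ≤ 1), ‖ρ₁ φ - ρ₂ φ‖ₑ

/-- The Gleason part of `ρ`: all characters `σ` with `‖σ - ρ‖ < 2`. -/
def gleasonPart (ρ : Character H) : Set (Character H) := {σ | charDist σ ρ < 2}

/-- A set of characters is a Gleason part if it is the Gleason part of some character. -/
def IsGleasonPart (S : Set (Character H)) : Prop := ∃ ρ : Character H, S = gleasonPart ρ

variable (H)

/-- The weak-* topology on `B(H)` as the dual of the trace class operators (the σ-weak topology):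
the coarsest topology such that the functionals `T ↦ ∑ₙ ⟨T fₙ, gₙ⟩`, with `(fₙ)` and `(gₙ)` square
summable sequences in `H`, are continuous. -/
abbrev sigmaWeak : TopologicalSpace (H →L[ℂ] H) :=
  ⨅ (f : lp (fun _ : ℕ => H) 2) (g : lp (fun _ : ℕ => H) 2),
    TopologicalSpace.induced (fun T => ∑' n, inner ℂ (g n) (T (f n))) inferInstance

/-- The weak-* topology on `Mult(H)`, identified via `φ ↦ M_φ` with a subalgebra of `B(H)`. -/
abbrev weakStar : TopologicalSpace (Mult H) := TopologicalSpace.induced mulOp (sigmaWeak H)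

variable {H}

/-- Weak-* continuity of a character. -/
def IsWeakStarContinuous (ρ : Character H) : Prop := @Continuous (Mult H) ℂ (weakStar H) _ ρ

/-- A bounded functional `ρ` on `H` is partially multiplicative if it is nonzero and
`ρ(f g) = ρ(f) ρ(g)` whenever `f, g ∈ H` are such that `f g ∈ H`. -/
def IsPartiallyMultiplicative (ρ : StrongDual ℂ H) : Prop :=
  ρ ≠ 0 ∧ ∀ f g h : H, (∀ x, h x = f x * g x) → ρ h = ρ f * ρ g

/-- The functional `τ` on `H` extends the character `ρ`: every multiplier belongs to `H`, and there
`τ` agrees with `ρ`. -/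
def Extends (τ : StrongDual ℂ H) (ρ : Character H) : Prop :=
  ∀ φ : Mult H, ∃ f : H, (∀ x, f x = (φ : X → ℂ) x) ∧ τ f = ρ φ

variable (H)

/-- `X` is a maximal domain for `H`: every bounded partially multiplicative functional on `H` is the
evaluation at a point of `X`. -/
def IsMaximalDomain : Prop :=
  ∀ ρ : StrongDual ℂ H, IsPartiallyMultiplicative ρ → ∃ x : X, ∀ f : H, ρ f = f x

end Defs

end PickSpace

end

noncomputable section

universe u v

namespace PickSpace

open scoped InnerProductSpace ComplexConjugate Matrix Topology
open Filter

/-! ### Positive semidefinite kernels and Gram kernels -/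

section PosSemidef

variable {ι : Type*}

/-! The Pick property enters through the McCullough-Quiggin theorem: `1 - 1/k` is a positive
semidefinite kernel (`IsCompletePick.posSemidef_one_sub_inv`). Writing it as a Gram kernel makes its
Gram vectors a contractive row multiplier. Hence `c_w = 1 - 1/k_w` is a strictly contractive
multiplier, `k_w = 1/(1 - c_w)` is a multiplier too, and multipliers are dense in `H`. The same row
yields the factorization of every unit vector as `f = φ/(1 - ψ)` with `φ`, `ψ` contractive and
`ψ(x₀) = 0` (`IsCompletePick.exists_factorization`).

For characters the equivalences form a circle. A character that extends to `H` is a vector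
functional `φ ↦ ⟪t, φ·1⟫`, hence weak-* continuous. If a weak-* continuous `ρ` had distance 2 from
`δ_x`, there would be contractive `φ_n` with `φ_n(x) → -1` and `ρ(φ_n) → 1`. Near-equality in
Cauchy-Schwarz at the cyclic vector `k_x` then forces `M_{φ_n} → -1` strongly, so `ρ(φ_n) → -1`, a
contradiction (`IsCompletePick.mem_gleasonPart`). Finally, distance less than 2 from `δ_{x₀}` gives
`r < 1` with `|ρ(ψ)| ≤ r` for contractive `ψ` vanishing at `x₀`. The factorization turns this into
`|ρ(f)| ≤ ‖f‖/(1 - r)` on multipliers, so `ρ` extends by density, and it is partially multiplicative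
because elements of `H` are quotients of multipliers.

Since the middle step works at every point `x`, all evaluations lie in one Gleason part, which is
the set of weak-* continuous characters. The second equivalence follows. -/

theorem sum_inner_eq_inner_linearCombination {E : Type*} [SeminormedAddCommGroup E]
    [InnerProductSpace ℂ E] (v : ι → E) (x : ι →₀ ℂ) :
    (x.sum fun i xi ↦ x.sum fun j xj ↦ star xi * ⟪v i, v j⟫_ℂ * xj) =
      ⟪Finsupp.linearCombination ℂ v x, Finsupp.linearCombination ℂ v x⟫_ℂ := by
  simp only [Finsupp.linearCombination_apply, Finsupp.sum]
  rw [sum_inner]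
  refine Finset.sum_congr rfl fun i _ ↦ ?_
  rw [inner_sum]
  refine Finset.sum_congr rfl fun j _ ↦ ?_
  rw [inner_smul_left, inner_smul_right, RCLike.star_def]
  ring

/-- Gram matrices over an arbitrary index type are positive semidefinite. -/
theorem posSemidef_of_inner {E : Type*} [SeminormedAddCommGroup E] [InnerProductSpace ℂ E]
    (v : ι → E) : (Matrix.of fun i j ↦ ⟪v i, v j⟫_ℂ).PosSemidef := by
  refine ⟨Matrix.ext fun i j ↦ by simp, fun x ↦ ?_⟩
  simp only [Matrix.of_apply]
  rw [sum_inner_eq_inner_linearCombination, inner_self_eq_norm_sq_to_K]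
  simp

/-- A difference of Gram matrices is positive semidefinite exactly when the corresponding vectors
are related by a contraction. -/
theorem posSemidef_sub_iff {E F : Type*} [SeminormedAddCommGroup E] [InnerProductSpace ℂ E]
    [SeminormedAddCommGroup F] [InnerProductSpace ℂ F] (u : ι → E) (v : ι → F) :
    (Matrix.of fun i j ↦ ⟪u i, u j⟫_ℂ - ⟪v i, v j⟫_ℂ).PosSemidef ↔
      ∀ x : ι →₀ ℂ, ‖Finsupp.linearCombination ℂ v x‖ ≤ ‖Finsupp.linearCombination ℂ u x‖ := by
  have key (x : ι →₀ ℂ) : (x.sum fun i xi ↦ x.sum fun j xj ↦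
      star xi * (Matrix.of fun i j ↦ ⟪u i, u j⟫_ℂ - ⟪v i, v j⟫_ℂ) i j * xj) =
      ((‖Finsupp.linearCombination ℂ u x‖ ^ 2 - ‖Finsupp.linearCombination ℂ v x‖ ^ 2 : ℝ) : ℂ) := by
    have h1 := sum_inner_eq_inner_linearCombination u x
    have h2 := sum_inner_eq_inner_linearCombination v x
    rw [inner_self_eq_norm_sq_to_K] at h1 h2
    push_cast
    refine Eq.trans ?_ (congrArg₂ (· - ·) h1 h2)
    simp only [Finsupp.sum, ← Finset.sum_sub_distrib, Matrix.of_apply, mul_sub, sub_mul]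
  constructor
  · intro h x
    have := h.2 x
    rw [key, Complex.zero_le_real, sub_nonneg] at this
    exact (sq_le_sq₀ (norm_nonneg _) (norm_nonneg _)).1 this
  · intro h
    refine ⟨Matrix.ext fun i j ↦ by simp, fun x ↦ ?_⟩
    rw [key, Complex.zero_le_real, sub_nonneg]
    exact pow_le_pow_left₀ (norm_nonneg _) (h x) 2

/-- This is the Schur product theorem. -/
theorem posSemidef_of_mul {K L : ι → ι → ℂ} (hK : (Matrix.of K).PosSemidef)
    (hL : (Matrix.of L).PosSemidef) : (Matrix.of fun i j ↦ K i j * L i j).PosSemidef :=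
  hK.hadamard hL

theorem posSemidef_of_add {K L : ι → ι → ℂ} (hK : (Matrix.of K).PosSemidef)
    (hL : (Matrix.of L).PosSemidef) : (Matrix.of fun i j ↦ K i j + L i j).PosSemidef :=
  hK.add hL

theorem posSemidef_rankOne (a : ι → ℂ) :
    (Matrix.of fun i j ↦ a i * conj (a j)).PosSemidef := by
  convert posSemidef_of_inner (fun i ↦ conj (a i)) using 3
  simp [mul_comm]

theorem posSemidef_conj_mul {K : ι → ι → ℂ} (hK : (Matrix.of K).PosSemidef) (a : ι → ℂ) :
    (Matrix.of fun i j ↦ a i * conj (a j) * K i j).PosSemidef :=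
  posSemidef_of_mul (posSemidef_rankOne a) hK

/-- Positive semidefiniteness can be tested on finite families. -/
theorem posSemidef_of_forall_fin {K : ι → ι → ℂ}
    (h : ∀ (n : ℕ) (z : Fin n → ι), (Matrix.of fun i j ↦ K (z i) (z j)).PosSemidef) :
    (Matrix.of K).PosSemidef := by
  refine ⟨Matrix.ext fun i j ↦ ?_, fun x ↦ ?_⟩
  · have := (h 2 ![i, j]).1.apply 0 1
    simpa using this
  · classical
    let e := x.support.equivFin
    have h1 := ((h _ fun a ↦ (e.symm a : ι)).submatrix e).2
      (x.subtypeDomain (· ∈ x.support))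
    simpa [Finsupp.sum, ← Finset.sum_attach x.support, ← Finset.subtype_mem_eq_attach,
      ← Finsupp.subtypeDomain_apply, ← Finsupp.support_subtypeDomain] using h1

/-- A positive semidefinite kernel is a Gram kernel (Moore-Aronszajn). -/
theorem exists_feature {ι : Type u} {K : ι → ι → ℂ} (hK : (Matrix.of K).PosSemidef) :
    ∃ (E : Type u) (_ : NormedAddCommGroup E) (_ : InnerProductSpace ℂ E) (_ : CompleteSpace E)
      (v : ι → E), ∀ i j, ⟪v i, v j⟫_ℂ = K i j := by
  -- Reproducing kernels are operator-valued here, so the scalar `K i j` is replaced by the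
  -- corresponding operator on `ℂ`.
  let K' : Matrix ι ι (ℂ →L[ℂ] ℂ) := .of fun i j ↦ K i j • ContinuousLinearMap.id ℂ ℂ
  have hK' : K'.PosSemidef := by
    have h02 := (RKHS.posSemidef_tfae (K := K')).out 0 2
    refine h02.2 ⟨Matrix.ext fun i j ↦ ?_, fun x ↦ ?_⟩
    · have := hK.1.apply i j
      simp only [Matrix.of_apply] at this
      simp [K', ← this, ContinuousLinearMap.star_eq_adjoint]
      exact congrArg _ (star_one (ℂ →L[ℂ] ℂ))
    · have := hK.2 x
      rw [Finsupp.sum_comm] at this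
      refine (Complex.nonneg_iff.1 this).1.trans_eq ?_
      rw [RCLike.re_eq_complex_re, ← Complex.conj_re]
      congr 1
      simp only [Finsupp.sum, map_sum]
      refine Finset.sum_congr rfl fun i _ ↦ Finset.sum_congr rfl fun j _ ↦ ?_
      simp [K']
      ring
  have : Fact K'.PosSemidef := ⟨hK'⟩
  refine ⟨RKHS.OfKernel K', inferInstance, inferInstance, inferInstance,
    fun i ↦ RKHS.kerFun (RKHS.OfKernel K') i 1, fun i j ↦ ?_⟩
  rw [RKHS.kerFun_inner, RKHS.kerFun_apply, RKHS.OfKernel.kernel_ofKernel]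
  simp [K']

end PosSemidef

/-! ### Kernel functions, multiplication operators and contractions -/

section Basic

variable {X : Type*} {H : Type*} [NormedAddCommGroup H] [InnerProductSpace ℂ H]
  [CompleteSpace H] [RKHS ℂ H X ℂ]

variable (H) in
/-- The kernel function `k_x`, representing evaluation at `x`. -/
def kfun (x : X) : H := RKHS.kerFun H x 1

@[simp]
theorem inner_kfun (x : X) (f : H) : ⟪kfun H x, f⟫_ℂ = f x := by
  simp [kfun]

theorem kfun_apply (z w : X) : kfun H w z = ker H z w := RKHS.kerFun_apply ..

theorem inner_kfun_kfun (z w : X) : ⟪kfun H z, kfun H w⟫_ℂ = ker H z w := by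
  rw [inner_kfun, kfun_apply]

theorem conj_ker (z w : X) : conj (ker H z w) = ker H w z := by
  rw [← inner_kfun_kfun, inner_conj_symm, inner_kfun_kfun]

variable (H) in
theorem posSemidef_ker : (Matrix.of (ker H)).PosSemidef := by
  convert posSemidef_of_inner (kfun H (X := X)) using 3
  simp [kfun_apply]

variable (H) in
theorem denseRange_linearCombination_kfun :
    DenseRange (Finsupp.linearCombination ℂ (kfun H (X := X))) := by
  have h := RKHS.kerFun_dense (𝕜 := ℂ) H (X := X) (V := ℂ)
  rw [DenseRange, ← LinearMap.coe_range, Finsupp.range_linearCombination,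
    Submodule.dense_iff_topologicalClosure_eq_top, ← h]
  congr 1
  refine le_antisymm (Submodule.span_mono ?_) (Submodule.span_le.2 ?_)
  · rintro _ ⟨x, rfl⟩
    exact ⟨x, 1, rfl⟩
  · rintro _ ⟨x, v, rfl⟩
    have : RKHS.kerFun H x v = v • kfun H x := by
      rw [kfun, ← map_smul, smul_eq_mul, mul_one]
    rw [this]
    exact Submodule.smul_mem _ _ (Submodule.subset_span ⟨x, rfl⟩)

/-- A domination of positive semidefinite kernels gives a bounded operator. -/
theorem exists_clm_of_posSemidef {E : Type*} [NormedAddCommGroup E] [InnerProductSpace ℂ E]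
    [CompleteSpace E] {C : ℝ} (hC : 0 ≤ C) (u : X → E)
    (h : (Matrix.of fun z w ↦ (C : ℂ) ^ 2 * ker H z w - ⟪u z, u w⟫_ℂ).PosSemidef) :
    ∃ T : H →L[ℂ] E, (∀ z, T (kfun H z) = u z) ∧ ‖T‖ ≤ C := by
  have h1 : ∀ x : X →₀ ℂ, ‖Finsupp.linearCombination ℂ u x‖ ≤
      C * ‖Finsupp.linearCombination ℂ (kfun H) x‖ := by
    intro x
    have := (posSemidef_sub_iff (fun z ↦ (C : ℂ) • kfun H z) u).1 (by
      convert h using 4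
      rw [inner_smul_left, inner_smul_right, inner_kfun_kfun, Complex.conj_ofReal]
      ring) x
    refine this.trans_eq ?_
    have h2 : Finsupp.linearCombination ℂ (fun z ↦ (C : ℂ) • kfun H z) x =
        (C : ℂ) • Finsupp.linearCombination ℂ (kfun H) x := by
      simp only [Finsupp.linearCombination_apply, Finsupp.smul_sum, smul_comm (C : ℂ)]
    rw [h2, norm_smul, Complex.norm_real, Real.norm_of_nonneg hC]
  have hd := denseRange_linearCombination_kfun (X := X) H
  refine ⟨(Finsupp.linearCombination ℂ u).extendOfNorm (Finsupp.linearCombination ℂ (kfun H)),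
    fun z ↦ ?_, LinearMap.opNorm_extendOfNorm_le hd hC h1⟩
  have := LinearMap.extendOfNorm_eq hd ⟨C, h1⟩ (Finsupp.single z 1)
  simpa using this

omit [CompleteSpace H] in
theorem ext_mult {φ ψ : Mult H} (h : ∀ x, (φ : X → ℂ) x = (ψ : X → ℂ) x) : φ = ψ :=
  Subtype.ext (funext h)

theorem mulOp_one : mulOp (1 : Mult H) = 1 := by
  ext f x
  simp [mulOp_apply]

theorem mulOp_mul (φ ψ : Mult H) : mulOp (φ * ψ) = mulOp φ * mulOp ψ := by
  ext f x
  simp [mulOp_apply, mul_assoc]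

theorem mulOp_add (φ ψ : Mult H) : mulOp (φ + ψ) = mulOp φ + mulOp ψ := by
  ext f x
  simp [mulOp_apply, add_mul]

theorem mulOp_sub (φ ψ : Mult H) : mulOp (φ - ψ) = mulOp φ - mulOp ψ := by
  ext f x
  simp [mulOp_apply, sub_mul]

theorem mulOp_smul (c : ℂ) (φ : Mult H) : mulOp (c • φ) = c • mulOp φ := by
  ext f x
  simp [mulOp_apply, mul_assoc]

/-- A function `φ` with `k(z, w) (C² - φ(z) φ(w)^*) ≥ 0` is a multiplier of norm at most `C`. -/
theorem exists_mult_of_posSemidef {C : ℝ} (hC : 0 ≤ C) (φ : X → ℂ)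
    (h : (Matrix.of fun z w ↦ ker H z w * ((C : ℂ) ^ 2 - φ z * conj (φ w))).PosSemidef) :
    ∃ Φ : Mult H, (∀ x, (Φ : X → ℂ) x = φ x) ∧ ‖mulOp Φ‖ ≤ C := by
  -- `T` is the future adjoint of multiplication by `φ`, for which every `k_z` is an eigenvector
  -- with eigenvalue `conj (φ z)`.
  obtain ⟨T, hT, hTC⟩ := exists_clm_of_posSemidef (H := H) hC (fun z ↦ conj (φ z) • kfun H z) (by
    convert h using 3 with z
    funext w
    rw [inner_smul_left, inner_smul_right, inner_kfun_kfun, Complex.conj_conj]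
    ring)
  have hTf : ∀ f x, T.adjoint f x = φ x * f x := by
    intro f x
    rw [← inner_kfun, ContinuousLinearMap.adjoint_inner_right, hT, inner_smul_left,
      Complex.conj_conj, inner_kfun]
  let Φ : Mult H := ⟨φ, fun f ↦ ⟨T.adjoint f, hTf f⟩⟩
  refine ⟨Φ, fun x ↦ rfl, ?_⟩
  have : mulOp Φ = T.adjoint := by
    ext f x
    rw [mulOp_apply, hTf]
  rwa [this, LinearIsometryEquiv.norm_map]

theorem inner_self_eq_ofReal_norm_sq {E : Type*} [NormedAddCommGroup E] [InnerProductSpace ℂ E]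
    (h : E) : ⟪h, h⟫_ℂ = ((‖h‖ ^ 2 : ℝ) : ℂ) := by
  rw [inner_self_eq_norm_sq_to_K]
  push_cast
  rfl

/-- A contraction `T` with `⟨h, T h⟩` close to `c ‖h‖²` maps `h` close to `c h`. -/
theorem norm_map_sub_sq_le {E : Type*} [NormedAddCommGroup E] [InnerProductSpace ℂ E]
    {T : E →L[ℂ] E} (hT : ‖T‖ ≤ 1) (h : E) (c : ℂ) :
    ‖T h - c • h‖ ^ 2 ≤ (1 + ‖c‖ ^ 2) * ‖h‖ ^ 2 - 2 * (conj c * ⟪h, T h⟫_ℂ).re := by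
  have h1 : ‖T h‖ ≤ ‖h‖ := (T.le_opNorm h).trans (mul_le_of_le_one_left (norm_nonneg _) hT)
  have h2 : ‖T h‖ ^ 2 ≤ ‖h‖ ^ 2 := pow_le_pow_left₀ (norm_nonneg _) h1 2
  have h3 := norm_sub_sq (𝕜 := ℂ) (T h) (c • h)
  rw [h3, norm_smul, mul_pow]
  have h4 : RCLike.re ⟪T h, c • h⟫_ℂ = (conj c * ⟪h, T h⟫_ℂ).re := by
    rw [RCLike.re_eq_complex_re, ← Complex.conj_re, inner_conj_symm, inner_smul_left]
  rw [h4]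
  linarith

/-- Equality case of the Cauchy-Schwarz inequality for a contraction. -/
theorem map_eq_self_of_inner_eq {E : Type*} [NormedAddCommGroup E] [InnerProductSpace ℂ E]
    {T : E →L[ℂ] E} (hT : ‖T‖ ≤ 1) {h : E} (hh : ⟪h, T h⟫_ℂ = ⟪h, h⟫_ℂ) : T h = h := by
  have h1 := norm_map_sub_sq_le hT h 1
  rw [hh, inner_self_eq_ofReal_norm_sq, map_one, one_mul, Complex.ofReal_re, norm_one] at h1
  have h4 : ‖T h - (1 : ℂ) • h‖ = 0 := by
    nlinarith [norm_nonneg (T h - (1 : ℂ) • h)]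
  rw [one_smul] at h4
  exact sub_eq_zero.1 (norm_eq_zero.1 h4)

end Basic

/-! ### Consequences of the normalization `k(·, x₀) = 1` -/

section Normalized

variable {X : Type*} {H : Type*} [NormedAddCommGroup H] [InnerProductSpace ℂ H]
  [CompleteSpace H] [RKHS ℂ H X ℂ] {x₀ : X}

theorem IsNormalizedAt.kfun_apply (hx₀ : IsNormalizedAt H x₀) (x : X) : kfun H x₀ x = 1 := by
  rw [PickSpace.kfun_apply, hx₀]

theorem IsNormalizedAt.ker_left (hx₀ : IsNormalizedAt H x₀) (x : X) : ker H x₀ x = 1 := by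
  rw [← conj_ker, hx₀, map_one]

theorem IsNormalizedAt.mulOp_kfun (hx₀ : IsNormalizedAt H x₀) (φ : Mult H) (x : X) :
    mulOp φ (kfun H x₀) x = (φ : X → ℂ) x := by
  rw [mulOp_apply, hx₀.kfun_apply, mul_one]

theorem IsNormalizedAt.kfun_ne_zero (hx₀ : IsNormalizedAt H x₀) (x : X) : kfun H x ≠ 0 := by
  intro h
  have := hx₀.ker_left x
  rw [← PickSpace.kfun_apply, h] at this
  simp at this

/-- If `φ` is a strictly contractive multiplier, then `1 - φ` is invertible. -/
theorem IsNormalizedAt.exists_inverse (hx₀ : IsNormalizedAt H x₀) {φ : Mult H}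
    (hφ : ‖mulOp φ‖ < 1) : ∃ ψ : Mult H, (1 - φ) * ψ = 1 := by
  obtain ⟨u, hu⟩ := isUnit_one_sub_of_norm_lt_one hφ
  let T : H →L[ℂ] H := ↑u⁻¹
  have hT : ∀ f x, (1 - (φ : X → ℂ) x) * T f x = f x := by
    intro f x
    have h1 : mulOp (1 - φ) (T f) = f := by
      rw [mulOp_sub, mulOp_one, ← hu, ← mul_apply_eq_comp, Units.mul_inv,
        one_apply_eq_self]
    have h2 := mulOp_apply (1 - φ) (T f) x
    rw [h1] at h2
    exact h2.symm
  have h1 : ∀ x, (1 - (φ : X → ℂ) x) * T (kfun H x₀) x = 1 := fun x ↦ by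
    rw [hT, hx₀.kfun_apply]
  -- By `h1`, `1 - φ(x)` has inverse `(T 1)(x)` at each point, so the operator inverse `T` is itself
  -- multiplication by the function `T 1`.
  let ψ : Mult H := ⟨fun x ↦ T (kfun H x₀) x, fun f ↦ ⟨T f, fun x ↦ by
    rw [← hT f x, ← mul_assoc, mul_comm (T (kfun H x₀) x), h1, one_mul]⟩⟩
  exact ⟨ψ, ext_mult h1⟩

end Normalized

/-! ### The McCullough-Quiggin theorem -/

section CompletePick

variable {X : Type*} {H : Type*} [NormedAddCommGroup H] [InnerProductSpace ℂ H]
  [CompleteSpace H] [RKHS ℂ H X ℂ] {x₀ : X}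

theorem ker_self_nonneg (x : X) : 0 ≤ ker H x x := by
  rw [← inner_kfun_kfun, inner_self_eq_ofReal_norm_sq]
  exact Complex.zero_le_real.2 (sq_nonneg _)

theorem IsContractive.norm_mulOp_le {Φ : Matrix (Fin 1) (Fin 1) (Mult H)} (h : IsContractive Φ) :
    ‖mulOp (Φ 0 0)‖ ≤ 1 := by
  refine ContinuousLinearMap.opNorm_le_bound _ zero_le_one fun f ↦ ?_
  have := h fun _ ↦ f
  simp only [Finset.univ_unique, Fin.default_eq_zero, Finset.sum_singleton] at this
  rw [one_mul]
  exact (sq_le_sq₀ (norm_nonneg _) (norm_nonneg _)).1 this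

/-- A normalized complete Pick kernel has no zeros. -/
theorem IsCompletePick.ker_ne_zero (hPick : IsCompletePick H) (hx₀ : IsNormalizedAt H x₀)
    (z w : X) : ker H z w ≠ 0 := by
  intro hzw
  have hwz : ker H w z = 0 := by rw [← conj_ker, hzw, map_zero]
  -- If `k(z, w) = 0`, the Pick matrix for the values `1` at `z` and `0` at `w` is `diag(0, k(w,
  -- w))`. The interpolant fixes `k_z`, so it is `1` at `x₀`; hence it fixes the function `1`, which
  -- is incompatible with its value at `w`.
  obtain ⟨Φ, hΦ, hΦW⟩ := hPick 1 2 ![z, w] ![1, 0] (by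
    have h := Matrix.PosSemidef.diagonal
      (d := fun p : Fin 2 × Fin 1 ↦ if p.1 = 0 then (0 : ℂ) else ker H w w) (by
        intro p
        dsimp only
        split_ifs
        · exact le_rfl
        · exact ker_self_nonneg w)
    convert h using 1
    ext ⟨i, a⟩ ⟨j, b⟩
    obtain rfl := Subsingleton.elim a b
    fin_cases i <;> fin_cases j <;> simp [hzw, hwz])
  have hn := hΦ.norm_mulOp_le
  set φ := Φ 0 0
  have hz : (φ : X → ℂ) z = 1 := by simpa using hΦW 0 0 0
  have hw : (φ : X → ℂ) w = 0 := by simpa using hΦW 1 0 0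
  have h1 : mulOp φ (kfun H z) = kfun H z := map_eq_self_of_inner_eq hn (by
    rw [inner_kfun, inner_kfun, mulOp_apply, hz, one_mul])
  have h2 : (φ : X → ℂ) x₀ = 1 := by
    have := mulOp_apply φ (kfun H z) x₀
    rw [h1, kfun_apply, hx₀.ker_left, mul_one] at this
    exact this.symm
  have h3 : mulOp φ (kfun H x₀) = kfun H x₀ := map_eq_self_of_inner_eq hn (by
    rw [inner_kfun, inner_kfun, mulOp_apply, h2, one_mul])
  have h4 := hx₀.mulOp_kfun φ w
  rw [h3, hx₀.kfun_apply, hw] at h4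
  exact one_ne_zero h4

/-- A contractive row of multipliers is also contractive on the subspace of functions vanishing at
`y`, whose reproducing kernel is `k(z, w) - k(z, y) k(y, w) / k(y, y)`. -/
theorem posSemidef_of_row {r : ℕ} {Φ : Fin r → Mult H}
    (hΦ : ∀ f : Fin r → H, ‖∑ b, mulOp (Φ b) (f b)‖ ^ 2 ≤ ∑ b, ‖f b‖ ^ 2) {y : X}
    (hy : ker H y y ≠ 0) :
    (Matrix.of fun z w ↦ (ker H z w - ker H z y * ker H y w / ker H y y) *
      (1 - ∑ b, (Φ b : X → ℂ) z * conj ((Φ b : X → ℂ) w))).PosSemidef := by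
  -- `g z` is the projection of `k_z` onto the functions vanishing at `y`, and `v z` below is the
  -- image of `g z` under the adjoint of the row restricted to such functions.
  let g : X → H := fun z ↦ kfun H z - (ker H y z / ker H y y) • kfun H y
  have hgy (z : X) : g z y = 0 := by
    simp [g, kfun_apply, hy]
  have hg (z : X) (f : H) (hf : f y = 0) : ⟪g z, f⟫_ℂ = f z := by
    simp [g, hf]
  have hgg (z w : X) : ⟪g z, g w⟫_ℂ = ker H z w - ker H z y * ker H y w / ker H y y := by
    rw [hg _ _ (hgy w)]
    simp [g, kfun_apply]
    ring
  let v : X → PiLp 2 (fun _ : Fin r ↦ H) := fun z ↦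
    WithLp.toLp 2 fun b ↦ conj ((Φ b : X → ℂ) z) • g z
  have hv (z : X) (f : PiLp 2 (fun _ : Fin r ↦ H)) (hf : ∀ b, f b y = 0) :
      ⟪v z, f⟫_ℂ = ⟪g z, ∑ b, mulOp (Φ b) (f b)⟫_ℂ := by
    rw [PiLp.inner_apply, inner_sum]
    refine Finset.sum_congr rfl fun b _ ↦ ?_
    rw [hg _ _ (by rw [mulOp_apply, hf, mul_zero]), mulOp_apply, inner_smul_left,
      Complex.conj_conj, hg _ _ (hf b)]
  have hvv (z w : X) : ⟪g z, g w⟫_ℂ - ⟪v z, v w⟫_ℂ =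
      (ker H z w - ker H z y * ker H y w / ker H y y) *
      (1 - ∑ b, (Φ b : X → ℂ) z * conj ((Φ b : X → ℂ) w)) := by
    rw [← hgg, PiLp.inner_apply, mul_sub, mul_one, Finset.mul_sum]
    congr 1
    refine Finset.sum_congr rfl fun b _ ↦ ?_
    simp only [v, inner_smul_left, inner_smul_right, Complex.conj_conj]
    ring
  simp_rw [← hvv]
  refine (posSemidef_sub_iff g v).2 fun x ↦ ?_
  set f := Finsupp.linearCombination ℂ v x with hf
  have hfy : ∀ b, f b y = 0 := by
    intro b
    have h1 := Finsupp.apply_linearCombination ℂ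
      ((innerSL ℂ (kfun H y)).comp (PiLp.proj 2 (fun _ : Fin r ↦ H) b : _ →L[ℂ] H)).toLinearMap v x
    have h2 : ((innerSL ℂ (kfun H y)).comp
        (PiLp.proj 2 (fun _ : Fin r ↦ H) b : _ →L[ℂ] H)).toLinearMap ∘ v = 0 := by
      funext z
      simp [v, hgy]
    rw [h2, Finsupp.linearCombination_zero] at h1
    simpa using h1
  -- The components of `f` vanish at `y`, so the adjoint relation `hv` applies; with Cauchy-Schwarz
  -- it gives `‖f‖² ≤ ‖∑ x_z g_z‖ ‖f‖`.
  have h1 : ⟪f, f⟫_ℂ = ⟪Finsupp.linearCombination ℂ g x, ∑ b, mulOp (Φ b) (f b)⟫_ℂ := by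
    nth_rewrite 1 [hf]
    simp only [Finsupp.linearCombination_apply, Finsupp.sum]
    rw [sum_inner, sum_inner]
    refine Finset.sum_congr rfl fun z _ ↦ ?_
    rw [inner_smul_left, inner_smul_left, hv z f hfy]
  have h2 : ‖∑ b, mulOp (Φ b) (f b)‖ ≤ ‖f‖ := by
    refine (sq_le_sq₀ (norm_nonneg _) (norm_nonneg _)).1 ?_
    rw [PiLp.norm_sq_eq_of_L2]
    exact hΦ f
  have h3 : ‖f‖ * ‖f‖ ≤ ‖Finsupp.linearCombination ℂ g x‖ * ‖f‖ := by
    have h4 := norm_inner_le_norm (𝕜 := ℂ) (Finsupp.linearCombination ℂ g x)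
      (∑ b, mulOp (Φ b) (f b))
    rw [← h1, inner_self_eq_ofReal_norm_sq, Complex.norm_real, norm_pow, norm_norm, sq] at h4
    exact h4.trans (mul_le_mul_of_nonneg_left h2 (norm_nonneg _))
  rcases (norm_nonneg f).eq_or_lt with h | h
  · rw [← h]
    exact norm_nonneg _
  · exact le_of_mul_le_mul_right h3 h

/-- The McCullough-Quiggin theorem (necessity), on finite families of points. -/
theorem IsCompletePick.posSemidef_fin (hPick : IsCompletePick H) (hx₀ : IsNormalizedAt H x₀)
    (n : ℕ) : ∀ (y : X) (z : Fin n → X), (Matrix.of fun i j ↦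
      1 - ker H (z i) y * ker H y (z j) / (ker H y y * ker H (z i) (z j))).PosSemidef := by
  have hne := hPick.ker_ne_zero hx₀
  induction n with
  | zero =>
    intro y z
    convert! Matrix.PosSemidef.zero (n := Fin 0) (R := ℂ) using 1
    ext i
    exact i.elim0
  | succ n ih =>
    intro y z
    -- The induction hypothesis is used with base point `z 0` and the other `n` points. Since the
    -- kernel vanishes when either argument is `z 0`, its Gram vectors extend by `0` to all `n + 1`
    -- points.
    obtain ⟨m, v, hv⟩ := Matrix.posSemidef_iff_eq_sum_vecMulVec.1 (ih (z 0) fun i ↦ z i.succ)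
    let v' : Fin (n + 1) → Fin m → ℂ := Fin.cons 0 fun i a ↦ v a i
    have hG (i j : Fin (n + 1)) : ∑ a, v' i a * conj (v' j a) =
        1 - ker H (z i) (z 0) * ker H (z 0) (z j) /
          (ker H (z 0) (z 0) * ker H (z i) (z j)) := by
      have h00 := hne (z 0) (z 0)
      refine Fin.cases ?_ (fun i ↦ ?_) i
      · have := hne (z 0) (z j)
        simp [v', h00, this]
      · refine Fin.cases ?_ (fun j ↦ ?_) j
        · have := hne (z i.succ) (z 0)
          rw [mul_comm (ker H (z 0) (z 0)), div_self (mul_ne_zero this h00)]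
          simp [v']
        · have := congrFun (congrFun hv i) j
          simp only [Matrix.of_apply] at this
          rw [this, Matrix.sum_apply]
          simp [v', Matrix.vecMulVec_apply]
    -- The Gram vector is the first row of a square matrix; the extra zero column ensures that this
    -- row exists even if `m = 0`.
    let W : Fin (n + 1) → Matrix (Fin (m + 1)) (Fin (m + 1)) ℂ := fun i ↦
      Matrix.of fun p q ↦ if p = 0 then (Fin.cons 0 (v' i) : Fin (m + 1) → ℂ) q else 0
    have hW (i j : Fin (n + 1)) (p q : Fin (m + 1)) : (W i * (W j).conjTranspose) p q =
        if p = 0 ∧ q = 0 then ∑ a, v' i a * conj (v' j a) else 0 := by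
      by_cases hp : p = 0 <;> by_cases hq : q = 0 <;>
        simp [Matrix.mul_apply, W, hp, hq, Fin.sum_univ_succ]
    obtain ⟨Φ, hΦ, hΦW⟩ := hPick (m + 1) (n + 1) z W (by
      -- By `hG`, the `(0, 0)` part of the Pick matrix is the rank one kernel `k(zᵢ, z₀) k(z₀, zⱼ) /
      -- k(z₀, z₀)` with `z₀ = z 0`; the remaining part is `k` times a diagonal projection.
      let a : Fin (n + 1) × Fin (m + 1) → ℂ := fun p ↦ if p.2 = 0 then ker H (z p.1) (z 0) else 0
      have h1 := (posSemidef_rankOne a).smul (inv_nonneg.2 (ker_self_nonneg (H := H) (z 0)))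
      have h2 := posSemidef_of_mul
        ((posSemidef_ker (X := X) H).submatrix fun p : Fin (n + 1) × Fin (m + 1) ↦ z p.1)
        ((Matrix.PosSemidef.diagonal (d := fun p : Fin (m + 1) ↦ if p = 0 then (0 : ℂ) else 1) (by
          intro p
          dsimp only
          split_ifs
          · exact le_rfl
          · exact zero_le_one)).submatrix fun p : Fin (n + 1) × Fin (m + 1) ↦ p.2)
      convert h1.add h2 using 1
      ext ⟨i, p⟩ ⟨j, q⟩
      have hij := hne (z i) (z j)
      have h00 := hne (z 0) (z 0)
      simp only [Matrix.of_apply, Matrix.sub_apply, hW, hG, Matrix.add_apply, Matrix.smul_apply, a,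
        Matrix.diagonal_apply, Matrix.one_apply, smul_eq_mul]
      by_cases hp : p = 0 <;> by_cases hq : q = 0
      · subst hp hq
        simp only [if_true, and_self, conj_ker]
        field_simp
        ring
      · subst hp
        simp [hq, Ne.symm hq]
      · subst hq
        simp [hp]
      · by_cases hpq : p = q <;> simp [hp, hq, hpq])
    have hrow := (posSemidef_of_row (Φ := fun b ↦ Φ 0 b) (fun f ↦
      (Finset.single_le_sum (f := fun a ↦ ‖∑ b, mulOp (Φ a b) (f b)‖ ^ 2)
        (fun a _ ↦ sq_nonneg _) (Finset.mem_univ 0)).trans (hΦ f)) (hne y y)).submatrix z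
    -- At the interpolation nodes the factor `1 - ∑ Φ_b(zᵢ) conj Φ_b(zⱼ)` equals `k(zᵢ, z₀) k(z₀,
    -- zⱼ) / (k(z₀, z₀) k(zᵢ, zⱼ))`. Removing its rank one numerator and the constant leaves the
    -- claim at `y`.
    have h2 := (posSemidef_conj_mul hrow fun i ↦ (ker H (z i) (z 0))⁻¹).smul
      (ker_self_nonneg (H := H) (z 0))
    convert h2 using 1
    ext i j
    have hs : ∑ b, (Φ 0 b : X → ℂ) (z i) * conj ((Φ 0 b : X → ℂ) (z j)) =
        ∑ a, v' i a * conj (v' j a) := by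
      simp [hΦW, W, Fin.sum_univ_succ]
    have hij := hne (z i) (z j)
    have h00 := hne (z 0) (z 0)
    have hi0 := hne (z i) (z 0)
    have h0j := hne (z 0) (z j)
    have hyy := hne y y
    simp only [Matrix.of_apply, Matrix.smul_apply, smul_eq_mul, hs, hG, map_inv₀, conj_ker]
    field_simp
    ring

/-- For a normalized complete Pick kernel, `1 - 1 / k` is positive semidefinite. -/
theorem IsCompletePick.posSemidef_one_sub_inv (hPick : IsCompletePick H)
    (hx₀ : IsNormalizedAt H x₀) : (Matrix.of fun z w ↦ 1 - (ker H z w)⁻¹).PosSemidef := by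
  refine posSemidef_of_forall_fin fun n z ↦ ?_
  convert hPick.posSemidef_fin hx₀ n x₀ z using 5
  rw [hx₀, hx₀, hx₀.ker_left]
  simp

end CompletePick

/-! ### Row contraction, kernel multipliers and factorization of `H` -/

section Factorization

variable {X : Type u} {H : Type v} [NormedAddCommGroup H] [InnerProductSpace ℂ H]
  [CompleteSpace H] [RKHS ℂ H X ℂ] {x₀ : X}

/-- Writing `1 - 1 / k(z, w) = ⟨b(z), b(w)⟩`, the row `b` is a contractive multiplier. Here `E` plays
the role of the tensor product of `H` with the space in which `b` takes values. -/
theorem IsCompletePick.exists_row (hPick : IsCompletePick H) (hx₀ : IsNormalizedAt H x₀) :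
    ∃ (E : Type (max u v)) (_ : NormedAddCommGroup E) (_ : InnerProductSpace ℂ E)
      (V : X → H → E) (R : E →L[ℂ] H),
      (∀ z f w g, ⟪V z f, V w g⟫_ℂ = (1 - (ker H z w)⁻¹) * ⟪f, g⟫_ℂ) ∧ ‖R‖ ≤ 1 ∧
      ∀ w f z, R (V w f) z = (1 - (ker H z w)⁻¹) * f z := by
  obtain ⟨E, _, _, _, V, hV⟩ := exists_feature (posSemidef_of_mul
    ((hPick.posSemidef_one_sub_inv hx₀).submatrix (Prod.fst : X × H → X))
    (posSemidef_of_inner (Prod.snd : X × H → H)))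
  simp only [Matrix.of_apply] at hV
  -- `T` is contractive because `k - (1 - 1/k) k = 1` is positive semidefinite.
  obtain ⟨T, hT, hT1⟩ := exists_clm_of_posSemidef (H := H) zero_le_one (fun z ↦ V (z, kfun H z)) (by
    convert posSemidef_rankOne (fun _ : X ↦ (1 : ℂ)) using 3 with z
    funext w
    have := hPick.ker_ne_zero hx₀ z w
    rw [hV, inner_kfun_kfun]
    simp only [Complex.ofReal_one, map_one]
    field_simp
    ring)
  refine ⟨E, inferInstance, inferInstance, fun z f ↦ V (z, f), T.adjoint, fun z f w g ↦ hV _ _, ?_,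
    fun w f z ↦ ?_⟩
  · rwa [LinearIsometryEquiv.norm_map]
  · rw [← inner_kfun, ContinuousLinearMap.adjoint_inner_right, hT, hV, inner_kfun]

/-- The functions `1 - 1 / k(·, w)` are strictly contractive multipliers, and jointly they satisfy
the inequality expressing the contractivity of a row. -/
theorem IsCompletePick.exists_shift (hPick : IsCompletePick H) (hx₀ : IsNormalizedAt H x₀) :
    ∃ c : X → Mult H, (∀ w x, (c w : X → ℂ) x = 1 - (ker H x w)⁻¹) ∧ (∀ w, ‖mulOp (c w)‖ < 1) ∧
      ∀ F : X → H, (Matrix.of fun z w ↦ (1 - (ker H z w)⁻¹) * ⟪F z, F w⟫_ℂ -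
        ⟪mulOp (c z) (F z), mulOp (c w) (F w)⟫_ℂ).PosSemidef := by
  obtain ⟨E, _, _, V, R, hV, hR, hRV⟩ := hPick.exists_row hx₀
  have hRle (y : E) : ‖R y‖ ≤ ‖y‖ :=
    (R.le_opNorm y).trans (mul_le_of_le_one_left (norm_nonneg _) hR)
  let c : X → Mult H := fun w ↦ ⟨fun x ↦ 1 - (ker H x w)⁻¹, fun f ↦ ⟨R (V w f), hRV w f⟩⟩
  have hc (w : X) (f : H) : mulOp (c w) f = R (V w f) := by
    ext x
    rw [mulOp_apply, hRV]
  refine ⟨c, fun w x ↦ rfl, fun w ↦ ?_, fun F ↦ ?_⟩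
  · have hk : 0 < ‖kfun H w‖ := norm_pos_iff.2 (hx₀.kfun_ne_zero w)
    -- `t = 1 - 1/k(w, w)`, so that `‖V w f‖² = t ‖f‖²`.
    set t : ℝ := 1 - (‖kfun H w‖ ^ 2)⁻¹ with ht
    have ht1 : t < 1 := sub_lt_self _ (by positivity)
    refine lt_of_le_of_lt (ContinuousLinearMap.opNorm_le_bound _ (Real.sqrt_nonneg t)
      fun f ↦ ?_) ((Real.sqrt_lt' one_pos).2 (by simpa using ht1))
    have h1 : ‖V w f‖ ^ 2 = t * ‖f‖ ^ 2 := by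
      have := hV w f w f
      rw [inner_self_eq_ofReal_norm_sq, inner_self_eq_ofReal_norm_sq, ← inner_kfun_kfun,
        inner_self_eq_ofReal_norm_sq] at this
      exact_mod_cast this
    rw [hc]
    refine (hRle _).trans ?_
    rw [← Real.sqrt_sq (norm_nonneg f), ← Real.sqrt_mul' _ (sq_nonneg _), ← h1,
      Real.sqrt_sq (norm_nonneg _)]
  · have h1 := (posSemidef_sub_iff (fun z ↦ V z (F z)) (fun z ↦ R (V z (F z)))).2 fun x ↦ by
      have h2 := Finsupp.apply_linearCombination ℂ R.toLinearMap (fun z ↦ V z (F z)) x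
      refine le_trans (le_of_eq ?_) (hRle _)
      exact congrArg norm h2.symm
    convert h1 using 3 with z
    funext w
    rw [hV, hc, hc]

/-- Since `k_w = 1/(1 - c_w)` with `‖c_w‖ < 1`, the inverse of `1 - c_w` in the multiplier algebra
is `k_w`. -/
theorem IsCompletePick.exists_kernel_mult (hPick : IsCompletePick H) (hx₀ : IsNormalizedAt H x₀) :
    ∃ κ : X → Mult H, ∀ w x, (κ w : X → ℂ) x = ker H x w := by
  obtain ⟨c, hc, hc1, -⟩ := hPick.exists_shift hx₀
  choose κ hκ using fun w ↦ hx₀.exists_inverse (hc1 w)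
  refine ⟨κ, fun w x ↦ ?_⟩
  have h1 := congrFun (congrArg Subtype.val (hκ w)) x
  have h2 : (1 - (c w : X → ℂ) x) * (κ w : X → ℂ) x = 1 := h1
  rw [hc, sub_sub_cancel] at h2
  have := hPick.ker_ne_zero hx₀ x w
  field_simp at h2
  exact h2

/-- Every `f` in the unit sphere of `H` is of the form `f = φ / (1 - ψ)` with contractive multipliers
`φ` and `ψ` such that `ψ(x₀) = 0`. -/
theorem IsCompletePick.exists_factorization (hPick : IsCompletePick H) (hx₀ : IsNormalizedAt H x₀)
    {f : H} (hf : ‖f‖ = 1) : ∃ ψ φ : Mult H, ‖mulOp ψ‖ ≤ 1 ∧ ‖mulOp φ‖ ≤ 1 ∧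
      (ψ : X → ℂ) x₀ = 0 ∧ ∀ x, (1 - (ψ : X → ℂ) x) * f x = (φ : X → ℂ) x := by
  have hne := hPick.ker_ne_zero hx₀
  obtain ⟨c, hc, -, hD⟩ := hPick.exists_shift hx₀
  obtain ⟨κ, hκ⟩ := hPick.exists_kernel_mult hx₀
  -- With `A = ⟪F z, F w⟫` and `B = ⟪c_z F z, c_w F w⟫`, one has `k (A - B) = A + k ((1 - 1/k) A -
  -- B)`.
  have hE (F : X → H) : (Matrix.of fun z w ↦ ker H z w * (⟪F z, F w⟫_ℂ -
      ⟪mulOp (c z) (F z), mulOp (c w) (F w)⟫_ℂ)).PosSemidef := by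
    convert posSemidef_of_add (posSemidef_of_inner F)
      (posSemidef_of_mul (posSemidef_ker (X := X) H) (hD F)) using 3 with z
    funext w
    have := hne z w
    field_simp
    ring
  have hff : ⟪f, f⟫_ℂ = 1 := by rw [inner_self_eq_ofReal_norm_sq, hf]; norm_num
  let F : X → H := fun w ↦ mulOp (κ w) f
  have hFx (w x : X) : F w x = ker H x w * f x := by rw [mulOp_apply, hκ]
  have hcF (w : X) : mulOp (c w) (F w) = F w - f := by
    ext x
    have := hne x w
    simp only [mulOp_apply, hc, RKHS.coe_sub, Pi.sub_apply, hFx]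
    field_simp
  have hck (w : X) : mulOp (c w) (kfun H w) = kfun H w - kfun H x₀ := by
    ext x
    have := hne x w
    simp only [mulOp_apply, hc, RKHS.coe_sub, Pi.sub_apply, kfun_apply, hx₀ x]
    field_simp
  -- Up to an affine change, `u` is the Sarason function of `f`: `hP` below says that multiplication
  -- by `2u - 1` has positive real part.
  let u : X → ℂ := fun z ↦ ⟪F z, f⟫_ℂ
  have hu' (w : X) : ⟪f, F w⟫_ℂ = conj (u w) := (inner_conj_symm _ _).symm
  have hEF (z w : X) : ⟪F z, F w⟫_ℂ - ⟪mulOp (c z) (F z), mulOp (c w) (F w)⟫_ℂ =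
      u z + conj (u w) - 1 := by
    rw [hcF, hcF, inner_sub_left, inner_sub_right, inner_sub_right, hff, hu']
    ring
  have hP := hE F
  simp only [hEF] at hP
  have hu (z : X) : u z ≠ 0 := by
    intro h0
    have h1 : 0 ≤ ker H z z * (u z + conj (u z) - 1) := hP.diag_nonneg (i := z)
    have h2 : 0 < ker H z z := (ker_self_nonneg z).lt_of_ne' (hne z z)
    rw [h0, map_zero, add_zero, zero_sub, mul_neg, mul_one] at h1
    exact absurd (neg_nonneg.1 h1) (not_le_of_gt h2)
  -- A Cayley transform: dividing `u(z) + conj u(w) - 1` by `u(z) conj u(w)` gives `1 - ψ(z) conj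
  -- ψ(w)` for `ψ = 1 - 1/u`.
  obtain ⟨ψ, hψ, hψ1⟩ := exists_mult_of_posSemidef (H := H) zero_le_one (fun z ↦ 1 - (u z)⁻¹) (by
    convert posSemidef_conj_mul hP (fun z ↦ (u z)⁻¹) using 3 with z
    funext w
    have h1 := hu z
    have h2 : conj (u w) ≠ 0 := (map_ne_zero _).2 (hu w)
    simp only [Complex.ofReal_one, map_sub, map_one, map_inv₀]
    field_simp
    ring)
  -- The scalar `s w = -conj (f w / u w)` makes `G w` orthogonal to `f`. Then `hE G` becomes the
  -- positivity of `k(z, w) (1 - φ(z) conj φ(w))` for `φ = f/u`.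
  let s : X → ℂ := fun w ↦ -(conj (f w) / conj (u w))
  let G : X → H := fun w ↦ s w • F w + kfun H w
  have hcG (w : X) : mulOp (c w) (G w) = G w - (s w • f + kfun H x₀) := by
    simp only [G, map_add, map_smul, hcF, hck, smul_sub]
    abel
  have hGf (z : X) : ⟪G z, f⟫_ℂ = 0 := by
    have h1 := hu z
    have h2 : ⟪F z, f⟫_ℂ = u z := rfl
    simp only [G, inner_add_left, inner_smul_left, inner_kfun, h2, s, map_neg, map_div₀,
      Complex.conj_conj]
    field_simp
    ring
  have hfG (z : X) : ⟪f, G z⟫_ℂ = 0 := by rw [← inner_conj_symm, hGf, map_zero]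
  have hG0 (w : X) : G w x₀ = s w * f x₀ + 1 := by
    simp [G, hFx, kfun_apply, hx₀.ker_left]
  have hGk (z : X) : ⟪G z, kfun H x₀⟫_ℂ = conj (s z * f x₀ + 1) := by
    rw [← inner_conj_symm, inner_kfun, hG0]
  have hfk : ⟪f, kfun H x₀⟫_ℂ = conj (f x₀) := by rw [← inner_conj_symm, inner_kfun]
  have hEG (z w : X) : ⟪G z, G w⟫_ℂ - ⟪mulOp (c z) (G z), mulOp (c w) (G w)⟫_ℂ =
      1 - conj (s z) * s w := by
    rw [hcG, hcG]
    simp only [inner_sub_left, inner_sub_right, inner_add_left, inner_add_right, inner_smul_left,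
      inner_smul_right, hGf, hfG, hGk, hfk, hff, inner_kfun, hG0, hx₀.kfun_apply, map_add, map_mul,
      map_one]
    ring
  have hQ := hE G
  simp only [hEG] at hQ
  obtain ⟨φ, hφ, hφ1⟩ := exists_mult_of_posSemidef (H := H) zero_le_one (fun z ↦ f z / u z) (by
    convert hQ using 3 with z
    funext w
    simp only [s, Complex.ofReal_one, map_neg, map_div₀, Complex.conj_conj]
    ring)
  refine ⟨ψ, φ, hψ1, hφ1, ?_, fun x ↦ ?_⟩
  · have : F x₀ = f := by
      ext x
      rw [hFx, hx₀, one_mul]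
    have hu0 : u x₀ = 1 := by
      change ⟪F x₀, f⟫_ℂ = 1
      rw [this, hff]
    rw [hψ, hu0, inv_one, sub_self]
  · rw [hψ, hφ, sub_sub_cancel]
    ring

/-- Multipliers are dense in `H`. -/
theorem IsCompletePick.denseRange_mult (hPick : IsCompletePick H) (hx₀ : IsNormalizedAt H x₀) :
    DenseRange fun φ : Mult H ↦ mulOp φ (kfun H x₀) := by
  obtain ⟨κ, hκ⟩ := hPick.exists_kernel_mult hx₀
  refine (denseRange_linearCombination_kfun (X := X) H).mono ?_
  rintro _ ⟨x, rfl⟩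
  refine ⟨Finsupp.linearCombination ℂ κ x, ?_⟩
  let A : Mult H →ₗ[ℂ] H :=
    { toFun := fun φ ↦ mulOp φ (kfun H x₀)
      map_add' := fun φ ψ ↦ by rw [mulOp_add]; rfl
      map_smul' := fun a φ ↦ by rw [mulOp_smul]; rfl }
  have h := Finsupp.apply_linearCombination ℂ A κ x
  refine h.trans ?_
  congr 2
  funext w
  ext y
  exact (hx₀.mulOp_kfun (κ w) y).trans ((hκ w y).trans (kfun_apply y w).symm)

end Factorization

/-! ### Characters, Gleason parts and extension to `H` -/

section Characters

variable {X : Type*} {H : Type*} [NormedAddCommGroup H] [InnerProductSpace ℂ H]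
  [CompleteSpace H] [RKHS ℂ H X ℂ] {x₀ : X}

omit [CompleteSpace H] in
theorem evalChar_apply (x : X) (φ : Mult H) : evalChar H x φ = (φ : X → ℂ) x := rfl

/-- Characters are contractive. -/
theorem IsNormalizedAt.norm_character_le (hx₀ : IsNormalizedAt H x₀) (ρ : Character H)
    (φ : Mult H) : ‖ρ φ‖ ≤ ‖mulOp φ‖ := by
  by_contra! h
  have h0 : 0 < ‖ρ φ‖ := (norm_nonneg _).trans_lt h
  have h1 : ‖mulOp ((ρ φ)⁻¹ • φ)‖ < 1 := by
    rw [mulOp_smul, norm_smul, norm_inv, inv_mul_lt_iff₀ h0, mul_one]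
    exact h
  obtain ⟨ψ, hψ⟩ := hx₀.exists_inverse h1
  have h2 := congrArg ρ hψ
  rw [map_mul, map_sub, map_one, map_smul, smul_eq_mul, inv_mul_cancel₀ (norm_pos_iff.1 h0),
    sub_self, zero_mul] at h2
  exact zero_ne_one h2

theorem exists_unimodular_mul_eq_norm (z : ℂ) : ∃ c : ℂ, ‖c‖ = 1 ∧ c * z = ‖z‖ := by
  rcases eq_or_ne z 0 with rfl | hz
  · exact ⟨1, by simp, by simp⟩
  · have hz' : (‖z‖ : ℂ) ≠ 0 := by exact_mod_cast norm_ne_zero_iff.2 hz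
    refine ⟨conj z / ‖z‖, ?_, ?_⟩
    · rw [norm_div, Complex.norm_conj, Complex.norm_real, norm_norm,
        div_self (norm_ne_zero_iff.2 hz)]
    · rw [div_mul_eq_mul_div, Complex.conj_mul', sq, mul_div_assoc, div_self hz', mul_one]

/-- Möbius transformations of contractive multipliers are contractive multipliers. -/
theorem IsNormalizedAt.exists_moebius (hx₀ : IsNormalizedAt H x₀) {φ : Mult H}
    (hφ : ‖mulOp φ‖ ≤ 1) {a : ℝ} (ha0 : 0 ≤ a) (ha1 : a < 1) :
    ∃ ψ : Mult H, ‖mulOp ψ‖ ≤ 1 ∧ (1 - (a : ℂ) • φ) * ψ = φ - (a : ℂ) • 1 := by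
  obtain ⟨χ, hχ⟩ := hx₀.exists_inverse (φ := (a : ℂ) • φ) (by
    rw [mulOp_smul, norm_smul, Complex.norm_real, Real.norm_of_nonneg ha0]
    exact (mul_le_of_le_one_right ha0 hφ).trans_lt ha1)
  refine ⟨(φ - (a : ℂ) • 1) * χ, ?_, by rw [mul_left_comm, hχ, mul_one]⟩
  refine ContinuousLinearMap.opNorm_le_bound _ zero_le_one fun f ↦ ?_
  set h := mulOp χ f
  have h1 : mulOp ((φ - (a : ℂ) • 1) * χ) f = mulOp φ h - (a : ℂ) • h := by
    rw [mulOp_mul, mulOp_sub, mulOp_smul, mulOp_one]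
    rfl
  have h2 : f = h - (a : ℂ) • mulOp φ h := by
    have h3 := congrArg (fun χ ↦ mulOp χ f) hχ
    simp only [mulOp_mul, mulOp_sub, mulOp_smul, mulOp_one] at h3
    exact h3.symm
  rw [one_mul, h1, congrArg norm h2]
  -- With `T = mulOp φ`, the difference of the squares is `‖h - a T h‖² - ‖T h - a h‖² = (1 -
  -- a²)(‖h‖² - ‖T h‖²)`.
  refine (sq_le_sq₀ (norm_nonneg _) (norm_nonneg _)).1 ?_
  have h4 : ‖mulOp φ h‖ ^ 2 ≤ ‖h‖ ^ 2 := pow_le_pow_left₀ (norm_nonneg _)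
    (((mulOp φ).le_opNorm h).trans (mul_le_of_le_one_left (norm_nonneg _) hφ)) 2
  have h5 : RCLike.re ⟪mulOp φ h, h⟫_ℂ = RCLike.re ⟪h, mulOp φ h⟫_ℂ := inner_re_symm _ _
  rw [norm_sub_sq (𝕜 := ℂ), norm_sub_sq (𝕜 := ℂ), inner_smul_right, inner_smul_right, norm_smul,
    norm_smul, Complex.norm_real, Real.norm_of_nonneg ha0, RCLike.re_eq_complex_re,
    Complex.re_ofReal_mul, Complex.re_ofReal_mul]
  simp only [RCLike.re_eq_complex_re] at h5
  rw [h5]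
  nlinarith [mul_nonneg (sub_nonneg.2 h4) (by nlinarith : (0 : ℝ) ≤ 1 - a ^ 2)]

theorem norm_sub_le_charDist {ρ σ : Character H} (h : charDist ρ σ < 2) {φ : Mult H}
    (hφ : ‖mulOp φ‖ ≤ 1) : ‖ρ φ - σ φ‖ ≤ (charDist ρ σ).toReal := by
  rw [← toReal_enorm]
  refine ENNReal.toReal_mono (h.trans ENNReal.ofNat_lt_top).ne ?_
  exact le_iSup₂ (f := fun (φ : Mult H) (_ : ‖mulOp φ‖ ≤ 1) ↦ ‖ρ φ - σ φ‖ₑ) φ hφ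

/-- Characters in the Gleason part of `δ_{x₀}` are uniformly bounded away from `1` on contractive
multipliers vanishing at `x₀`. -/
theorem IsNormalizedAt.exists_lt_one (hx₀ : IsNormalizedAt H x₀) {ρ : Character H}
    (hρ : ρ ∈ gleasonPart (evalChar H x₀)) :
    ∃ r < 1, ∀ ψ : Mult H, ‖mulOp ψ‖ ≤ 1 → (ψ : X → ℂ) x₀ = 0 → ‖ρ ψ‖ ≤ r := by
  have hρ' : charDist ρ (evalChar H x₀) < 2 := hρ
  set a : ℝ := (charDist ρ (evalChar H x₀)).toReal / 2 with ha
  have hd : (charDist ρ (evalChar H x₀)).toReal = 2 * a := by rw [ha]; ring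
  have ha0 : 0 ≤ a := by positivity
  have ha1 : a < 1 := by
    have := (ENNReal.toReal_lt_toReal (hρ'.trans ENNReal.ofNat_lt_top).ne
      ENNReal.ofNat_ne_top).2 hρ'
    rw [hd, ENNReal.toReal_ofNat] at this
    linarith
  have hpos : 0 < 1 + a ^ 2 := by positivity
  -- Let `t = |ρ(ψ)|`, with `ψ` rotated so that `ρ(ψ) = t`. Its Möbius transform takes the values
  -- `(t - a)/(1 - a t)` at `ρ` and `-a` at `x₀`. Their difference `t (1 - a²)/(1 - a t)` is at most
  -- `2a`, which rearranges to `t ≤ 2a/(1 + a²)`.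
  refine ⟨2 * a / (1 + a ^ 2), ?_, fun ψ hψ hψ0 ↦ ?_⟩
  · rw [div_lt_one hpos]
    nlinarith [sq_pos_of_pos (sub_pos.2 ha1)]
  · obtain ⟨c, hc, hct⟩ := exists_unimodular_mul_eq_norm (ρ ψ)
    have ht1 : ‖ρ ψ‖ ≤ 1 := (hx₀.norm_character_le ρ ψ).trans hψ
    set t := ‖ρ ψ‖
    have h1 : ‖mulOp (c • ψ)‖ ≤ 1 := by rwa [mulOp_smul, norm_smul, hc, one_mul]
    obtain ⟨χ, hχ1, hχ⟩ := hx₀.exists_moebius h1 ha0 ha1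
    have h2 := congrArg ρ hχ
    have h3 := congrArg (evalChar H x₀) hχ
    simp only [map_mul, map_sub, map_one, map_smul, smul_eq_mul, hct, evalChar_apply, hψ0, mul_zero,
      sub_zero, one_mul, mul_one, zero_sub] at h2 h3
    have h4 := norm_sub_le_charDist hρ' hχ1
    rw [evalChar_apply, h3, hd, sub_neg_eq_add] at h4
    have hat : 0 < 1 - a * t := by nlinarith
    have h5 : ((1 - a * t : ℝ) : ℂ) * (ρ χ + a) = ((t * (1 - a ^ 2) : ℝ) : ℂ) := by
      push_cast
      rw [mul_add, h2]
      ring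
    have h6 := congrArg norm h5
    have ht0 : 0 ≤ t := norm_nonneg _
    rw [norm_mul, Complex.norm_real, Complex.norm_real, Real.norm_of_nonneg hat.le,
      Real.norm_of_nonneg (mul_nonneg ht0 (by nlinarith))] at h6
    have h7 := mul_le_mul_of_nonneg_left h4 hat.le
    rw [h6] at h7
    rw [le_div_iff₀ hpos]
    nlinarith

/-- Evaluation of multipliers in `H`, as a linear map. -/
def multToFun (x₀ : X) : Mult H →ₗ[ℂ] H where
  toFun φ := mulOp φ (kfun H x₀)
  map_add' φ ψ := by rw [mulOp_add]; rfl
  map_smul' a φ := by rw [mulOp_smul]; rfl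

theorem IsNormalizedAt.multToFun_apply (hx₀ : IsNormalizedAt H x₀) (φ : Mult H) (x : X) :
    multToFun x₀ φ x = (φ : X → ℂ) x :=
  hx₀.mulOp_kfun φ x

theorem IsNormalizedAt.extends_iff (hx₀ : IsNormalizedAt H x₀) {τ : StrongDual ℂ H}
    {ρ : Character H} : Extends τ ρ ↔ ∀ φ, τ (multToFun x₀ φ) = ρ φ := by
  refine ⟨fun h φ ↦ ?_, fun h φ ↦ ⟨multToFun x₀ φ, hx₀.multToFun_apply φ, h φ⟩⟩
  obtain ⟨f, hf, hτ⟩ := h φ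
  rw [← hτ]
  congr 1
  ext x
  rw [hx₀.multToFun_apply, hf]

theorem mulOp_multToFun (φ ψ : Mult H) : mulOp φ (multToFun x₀ ψ) = multToFun x₀ (φ * ψ) := by
  change _ = mulOp (φ * ψ) (kfun H x₀)
  rw [mulOp_mul]
  rfl

/-- A character which is uniformly bounded away from `1` on contractive multipliers vanishing at
`x₀` extends to a bounded partially multiplicative functional. -/
theorem IsCompletePick.exists_extension (hPick : IsCompletePick H) (hx₀ : IsNormalizedAt H x₀)
    {ρ : Character H} {r : ℝ} (hr : r < 1)
    (hρ : ∀ ψ : Mult H, ‖mulOp ψ‖ ≤ 1 → (ψ : X → ℂ) x₀ = 0 → ‖ρ ψ‖ ≤ r) :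
    ∃ τ : StrongDual ℂ H, IsPartiallyMultiplicative τ ∧ Extends τ ρ := by
  have hd : DenseRange (multToFun x₀ : Mult H →ₗ[ℂ] H) := hPick.denseRange_mult hx₀
  -- The factorization rescaled to arbitrary norm, with `a = 1 - ψ` and `b = ‖f‖ φ`; the denominator
  -- satisfies `|ρ(a)| ≥ 1 - r > 0`.
  have hfac (f : H) : ∃ a b : Mult H, 1 - r ≤ ‖ρ a‖ ∧ ‖ρ b‖ ≤ ‖f‖ ∧
      ∀ x, (a : X → ℂ) x * f x = (b : X → ℂ) x := by
    rcases eq_or_ne f 0 with rfl | hf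
    · refine ⟨1, 0, ?_, by simp, by simp⟩
      have := hρ 0 (by rw [← zero_smul ℂ (0 : Mult H), mulOp_smul]; simp) rfl
      rw [map_zero, norm_zero] at this
      rw [map_one, norm_one]
      linarith
    · have hf0 : (‖f‖ : ℂ) ≠ 0 := by exact_mod_cast norm_ne_zero_iff.2 hf
      obtain ⟨ψ, φ, hψ, hφ, hψ0, h⟩ := hPick.exists_factorization hx₀
        (f := (‖f‖ : ℂ)⁻¹ • f) (by
          rw [norm_smul, norm_inv, Complex.norm_real, norm_norm,
            inv_mul_cancel₀ (norm_ne_zero_iff.2 hf)])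
      refine ⟨1 - ψ, (‖f‖ : ℂ) • φ, ?_, ?_, fun x ↦ ?_⟩
      · have h1 := norm_sub_norm_le (1 : ℂ) (ρ ψ)
        rw [norm_one] at h1
        rw [map_sub, map_one]
        linarith [hρ ψ hψ hψ0]
      · rw [map_smul, norm_smul, Complex.norm_real, norm_norm]
        exact mul_le_of_le_one_right (norm_nonneg _) ((hx₀.norm_character_le ρ φ).trans hφ)
      · have h1 := h x
        have h2 : ((‖f‖ : ℂ)⁻¹ • f) x = (‖f‖ : ℂ)⁻¹ * f x := by simp
        rw [h2] at h1
        change (1 - (ψ : X → ℂ) x) * f x = (‖f‖ : ℂ) * (φ : X → ℂ) x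
        rw [← h1]
        field_simp
  have hr0 : 0 < 1 - r := sub_pos.2 hr
  have hbound (φ : Mult H) : ‖ρ.toLinearMap φ‖ ≤ (1 - r)⁻¹ * ‖multToFun x₀ φ‖ := by
    obtain ⟨a, b, ha, hb, hab⟩ := hfac (multToFun x₀ φ)
    have h1 : a * φ = b := ext_mult fun x ↦ by
      rw [← hab, hx₀.multToFun_apply]
      rfl
    rw [← h1, map_mul, norm_mul] at hb
    rw [le_inv_mul_iff₀ hr0, AlgHom.toLinearMap_apply]
    exact (mul_le_mul_of_nonneg_right ha (norm_nonneg _)).trans hb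
  let τ : StrongDual ℂ H := ρ.toLinearMap.extendOfNorm (multToFun x₀)
  have hτ (φ : Mult H) : τ (multToFun x₀ φ) = ρ φ := LinearMap.extendOfNorm_eq hd ⟨_, hbound⟩ φ
  have hmul (φ : Mult H) (f : H) : τ (mulOp φ f) = ρ φ * τ f := by
    refine hd.induction (P := fun f ↦ τ (mulOp φ f) = ρ φ * τ f) ?_
      (isClosed_eq (by fun_prop) (by fun_prop)) f
    rintro _ ⟨ψ, rfl⟩
    rw [mulOp_multToFun, hτ, hτ, map_mul]
  -- The extension is determined by quotients: if `f = b/a` with `ρ(a) ≠ 0`, then `τ(f) =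
  -- ρ(b)/ρ(a)`. Multiplying the quotients for `f` and `g` gives partial multiplicativity.
  have hquot (f : H) {a b : Mult H} (h : ∀ x, (a : X → ℂ) x * f x = (b : X → ℂ) x) :
      ρ a * τ f = ρ b := by
    rw [← hmul, ← hτ]
    congr 1
    ext x
    rw [mulOp_apply, h, hx₀.multToFun_apply]
  refine ⟨τ, ⟨fun h0 ↦ ?_, fun f g h hfg ↦ ?_⟩, hx₀.extends_iff.2 hτ⟩
  · have := hτ 1
    rw [h0, map_one ρ] at this
    exact zero_ne_one this
  · obtain ⟨a, b, ha, -, hab⟩ := hfac f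
    obtain ⟨a', b', ha', -, hab'⟩ := hfac g
    have h1 := hquot f hab
    have h2 := hquot g hab'
    have h3 := hquot h (a := a * a') (b := b * b') fun x ↦ by
      change (a : X → ℂ) x * (a' : X → ℂ) x * h x = (b : X → ℂ) x * (b' : X → ℂ) x
      rw [← hab, ← hab', hfg]
      ring
    have ha0 : ρ a ≠ 0 := norm_pos_iff.1 (hr0.trans_le ha)
    have ha0' : ρ a' ≠ 0 := norm_pos_iff.1 (hr0.trans_le ha')
    rw [map_mul, map_mul, ← h1, ← h2] at h3
    apply mul_left_cancel₀ (mul_ne_zero ha0 ha0')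
    rw [h3]
    ring

/-- If `t` is the Riesz representative of `τ`, then `ρ(φ) = ⟪t, M_φ 1⟫`. This is a defining σ-weak
functional for two sequences supported at index `0`. -/
theorem IsNormalizedAt.isWeakStarContinuous_of_extends (hx₀ : IsNormalizedAt H x₀)
    {τ : StrongDual ℂ H} {ρ : Character H} (h : Extends τ ρ) : IsWeakStarContinuous ρ := by
  rw [hx₀.extends_iff] at h
  let t : H := (InnerProductSpace.toDual ℂ H).symm τ
  let F : lp (fun _ : ℕ ↦ H) 2 := lp.single 2 0 (kfun H x₀)
  let G : lp (fun _ : ℕ ↦ H) 2 := lp.single 2 0 t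
  have hρ : (ρ : Mult H → ℂ) =
      (fun T : H →L[ℂ] H ↦ ∑' n, ⟪G n, T (F n)⟫_ℂ) ∘ mulOp := by
    funext φ
    rw [← h, Function.comp_apply, tsum_eq_single 0]
    · simp [F, G, t, multToFun]
    · intro n hn
      simp [F, G, hn]
  unfold IsWeakStarContinuous
  rw [hρ]
  refine @Continuous.comp _ _ _ (weakStar H) (sigmaWeak H) _ _ _ ?_ continuous_induced_dom
  exact continuous_iInf_dom (i := F) (continuous_iInf_dom (i := G) continuous_induced_dom)

/-- Bounded strong operator convergence implies weak-* convergence. -/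
theorem IsWeakStarContinuous.tendsto {ρ : Character H} (hρ : IsWeakStarContinuous ρ)
    {φ : ℕ → Mult H} {ψ : Mult H} (hφ : ∀ n, ‖mulOp (φ n)‖ ≤ 1)
    (h : ∀ f : H, Tendsto (fun n ↦ mulOp (φ n) f) atTop (𝓝 (mulOp ψ f))) :
    Tendsto (fun n ↦ ρ (φ n)) atTop (𝓝 (ρ ψ)) := by
  have h1 : Tendsto φ atTop (@nhds _ (weakStar H) ψ) := by
    simp only [nhds_induced, nhds_iInf, tendsto_iInf, tendsto_comap_iff]
    intro F G
    refine tendsto_tsum_of_dominated_convergence (bound := fun n ↦ ‖G n‖ * ‖F n‖)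
      (lp.summable_mul (by
        have : (2 : ℝ≥0∞).toReal = 2 := by norm_num
        rw [this]
        exact Real.HolderConjugate.two_two) G F) (fun n ↦ ?_) (Eventually.of_forall fun m n ↦ ?_)
    · exact tendsto_const_nhds.inner (h (F n))
    · refine (norm_inner_le_norm _ _).trans (mul_le_mul_of_nonneg_left ?_ (norm_nonneg _))
      exact ((mulOp (φ m)).le_opNorm _).trans (mul_le_of_le_one_left (norm_nonneg _) (hφ m))
  exact (@Continuous.tendsto _ _ (weakStar H) _ _ hρ ψ).comp h1

/-- Contractive multipliers whose values at one point tend to `-1` converge strongly to `-1`. -/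
theorem IsCompletePick.tendsto_neg (hPick : IsCompletePick H) (hx₀ : IsNormalizedAt H x₀) {x : X}
    {φ : ℕ → Mult H} (hφ : ∀ n, ‖mulOp (φ n)‖ ≤ 1)
    (h : Tendsto (fun n ↦ (φ n : X → ℂ) x) atTop (𝓝 (-1))) (f : H) :
    Tendsto (fun n ↦ mulOp (φ n) f) atTop (𝓝 (-f)) := by
  obtain ⟨c, hc, -, -⟩ := hPick.exists_shift hx₀
  -- Convergence at `k_x` comes from near-equality in Cauchy-Schwarz, as `⟪k_x, φ_n k_x⟫ = φ_n(x)
  -- ‖k_x‖²`.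
  have h1 : Tendsto (fun n ↦ mulOp (φ n) (kfun H x)) atTop (𝓝 (-kfun H x)) := by
    rw [tendsto_iff_norm_sub_tendsto_zero]
    have h2 (n : ℕ) : ‖mulOp (φ n) (kfun H x) - -kfun H x‖ ^ 2 ≤
        2 * ‖kfun H x‖ ^ 2 + 2 * ((φ n : X → ℂ) x * (‖kfun H x‖ ^ 2 : ℝ)).re := by
      have := norm_map_sub_sq_le (hφ n) (kfun H x) (-1)
      rw [inner_kfun, mulOp_apply, kfun_apply, ← inner_kfun_kfun,
        inner_self_eq_ofReal_norm_sq] at this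
      simp only [neg_smul, one_smul, norm_neg, norm_one, map_neg, map_one, neg_mul, one_mul,
        Complex.neg_re] at this
      linarith
    have h3 : Tendsto (fun n ↦ 2 * ‖kfun H x‖ ^ 2 +
        2 * ((φ n : X → ℂ) x * (‖kfun H x‖ ^ 2 : ℝ)).re) atTop (𝓝 0) := by
      have h4 := (Complex.continuous_re.tendsto _).comp
        (h.mul_const ((‖kfun H x‖ ^ 2 : ℝ) : ℂ))
      have h5 := (h4.const_mul 2).const_add (2 * ‖kfun H x‖ ^ 2)
      rw [neg_one_mul, Complex.neg_re, Complex.ofReal_re, mul_neg, add_neg_cancel] at h5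
      exact h5
    have h6 := squeeze_zero (fun n ↦ sq_nonneg _) h2 h3
    have h7 := (Real.continuous_sqrt.tendsto _).comp h6
    simpa [Function.comp_def, Real.sqrt_sq] using h7
  have h2 (ψ : Mult H) : Tendsto (fun n ↦ mulOp (φ n) (multToFun x₀ ψ)) atTop
      (𝓝 (-multToFun x₀ ψ)) := by
    -- `k_x` is cyclic: `ψ = ψ (1 - c_x) k_x`, because `1 - c_x = 1/k_x`. Multiplication operators
    -- commute, so convergence at `k_x` passes to every multiplier.
    have h3 : multToFun x₀ ψ = mulOp (ψ * (1 - c x)) (kfun H x) := by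
      ext y
      have := hPick.ker_ne_zero hx₀ y x
      rw [hx₀.multToFun_apply, mulOp_apply, kfun_apply]
      change _ = (ψ : X → ℂ) y * (1 - (c x : X → ℂ) y) * ker H y x
      rw [hc]
      field_simp
      ring
    have h4 (n : ℕ) : mulOp (φ n) (multToFun x₀ ψ) =
        mulOp (ψ * (1 - c x)) (mulOp (φ n) (kfun H x)) := by
      rw [h3, ← mul_apply_eq_comp, ← mulOp_mul, mul_comm, mulOp_mul, mul_apply_eq_comp]
    simp_rw [h4]
    rw [h3, ← map_neg]
    exact ((mulOp (ψ * (1 - c x))).continuous.tendsto _).comp h1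
  rw [Metric.tendsto_atTop]
  intro ε hε
  obtain ⟨g, ⟨ψ, rfl⟩, hg⟩ := Metric.mem_closure_iff.1 (hPick.denseRange_mult hx₀ f) (ε / 4)
    (by positivity)
  obtain ⟨N, hN⟩ := Metric.tendsto_atTop.1 (h2 ψ) (ε / 4) (by positivity)
  refine ⟨N, fun n hn ↦ ?_⟩
  have h3 := hN n hn
  change dist f (multToFun x₀ ψ) < ε / 4 at hg
  rw [dist_eq_norm] at h3 hg ⊢
  have h4 : mulOp (φ n) f - -f = mulOp (φ n) (f - multToFun x₀ ψ) +
      (mulOp (φ n) (multToFun x₀ ψ) - -multToFun x₀ ψ) + (f - multToFun x₀ ψ) := by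
    rw [map_sub]
    abel
  have h5 : ‖mulOp (φ n) (f - multToFun x₀ ψ)‖ ≤ ‖f - multToFun x₀ ψ‖ :=
    ((mulOp (φ n)).le_opNorm _).trans (mul_le_of_le_one_left (norm_nonneg _) (hφ n))
  rw [h4]
  have h6 := norm_add₃_le (a := mulOp (φ n) (f - multToFun x₀ ψ))
    (b := mulOp (φ n) (multToFun x₀ ψ) - -multToFun x₀ ψ) (c := f - multToFun x₀ ψ)
  linarith

/-- Weak-* continuous characters belong to the Gleason part of every point evaluation. -/
theorem IsCompletePick.mem_gleasonPart (hPick : IsCompletePick H) (hx₀ : IsNormalizedAt H x₀)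
    {ρ : Character H} (hρ : IsWeakStarContinuous ρ) (x : X) :
    ρ ∈ gleasonPart (evalChar H x) := by
  by_contra hlt
  have hge : 2 ≤ charDist ρ (evalChar H x) := not_lt.1 hlt
  have hex (n : ℕ) : ∃ φ : Mult H, ‖mulOp φ‖ ≤ 1 ∧
      2 - 1 / ((n : ℝ) + 1) ≤ (ρ φ).re - ((φ : X → ℂ) x).re := by
    have hn : (0 : ℝ) < 1 / ((n : ℝ) + 1) := by positivity
    have h1 : ENNReal.ofReal (2 - 1 / ((n : ℝ) + 1)) < charDist ρ (evalChar H x) := by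
      refine lt_of_lt_of_le ?_ hge
      rw [ENNReal.ofReal_lt_iff_lt_toReal _ ENNReal.ofNat_ne_top, ENNReal.toReal_ofNat]
      · linarith
      · have : 1 / ((n : ℝ) + 1) ≤ 1 := by
          rw [div_le_one (by positivity)]
          linarith [(Nat.cast_nonneg n : (0 : ℝ) ≤ n)]
        linarith
    obtain ⟨φ, h2⟩ := lt_iSup_iff.1 h1
    obtain ⟨hφ, h3⟩ := lt_iSup_iff.1 h2
    rw [← ofReal_norm] at h3
    have h4 := (ENNReal.ofReal_lt_ofReal_iff'.1 h3).1
    -- Rotating `φ` makes `ρ(φ) - φ(x)` equal to its modulus, so real parts can be compared.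
    obtain ⟨c, hc, hcz⟩ := exists_unimodular_mul_eq_norm (ρ φ - evalChar H x φ)
    refine ⟨c • φ, by rwa [mulOp_smul, norm_smul, hc, one_mul], ?_⟩
    have h5 := congrArg Complex.re hcz
    rw [mul_sub, Complex.sub_re, Complex.ofReal_re] at h5
    rw [map_smul, smul_eq_mul]
    change _ ≤ _ - (c * evalChar H x φ).re
    rw [h5]
    exact h4.le
  choose φ hφ hφ2 using hex
  have hre (n : ℕ) (σ : Character H) : ‖σ (φ n)‖ ≤ 1 :=
    (hx₀.norm_character_le σ (φ n)).trans (hφ n)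
  have hlim : Tendsto (fun n ↦ (φ n : X → ℂ) x) atTop (𝓝 (-1)) := by
    rw [tendsto_iff_norm_sub_tendsto_zero]
    -- Since `Re ρ(φ_n) ≤ 1`, one has `Re φ_n(x) ≤ -1 + 1/(n+1)`; now expand `|φ_n(x) + 1|²` using
    -- `|φ_n(x)| ≤ 1`.
    have h1 (n : ℕ) : ‖(φ n : X → ℂ) x - -1‖ ^ 2 ≤ 2 * (1 / ((n : ℝ) + 1)) := by
      have h2 := hre n (evalChar H x)
      rw [evalChar_apply] at h2
      have h3 := (Complex.re_le_norm (ρ (φ n))).trans (hre n ρ)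
      have h4 := hφ2 n
      have h5 : ‖(φ n : X → ℂ) x‖ ^ 2 ≤ 1 := by nlinarith [norm_nonneg ((φ n : X → ℂ) x)]
      rw [← Complex.normSq_eq_norm_sq, Complex.normSq_apply] at h5 ⊢
      simp only [Complex.sub_re, Complex.sub_im, Complex.neg_re, Complex.neg_im, Complex.one_re,
        Complex.one_im]
      nlinarith
    have h6 := squeeze_zero (fun n ↦ sq_nonneg _) h1
      (by simpa using (tendsto_one_div_add_atTop_nhds_zero_nat (𝕜 := ℝ)).const_mul 2)
    have h7 := (Real.continuous_sqrt.tendsto _).comp h6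
    simpa [Function.comp_def, Real.sqrt_sq] using h7
  have h1 := hρ.tendsto (ψ := -1) hφ fun f ↦ by
    have h2 : mulOp (-1 : Mult H) f = -f := by
      have : (-1 : Mult H) = (-1 : ℂ) • 1 := by simp
      rw [this, mulOp_smul, mulOp_one]
      simp
    rw [h2]
    exact hPick.tendsto_neg hx₀ hφ hlim f
  have h3 := (Complex.continuous_re.tendsto _).comp h1
  -- The crude bound `Re ρ(φ_n) ≥ 0` already contradicts the limit `ρ(-1) = -1`.
  have h4 : (0 : ℝ) ≤ (ρ (-1)).re := ge_of_tendsto' h3 fun n ↦ by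
    have h5 := hφ2 n
    have h6 := (Complex.abs_re_le_norm _).trans (hre n (evalChar H x))
    rw [evalChar_apply] at h6
    have h7 : 1 / ((n : ℝ) + 1) ≤ 1 := by
      rw [div_le_one (by positivity)]
      linarith [(Nat.cast_nonneg n : (0 : ℝ) ≤ n)]
    simp only [Function.comp_apply]
    linarith [(abs_le.1 h6).1]
  rw [map_neg, map_one, Complex.neg_re, Complex.one_re] at h4
  linarith

/-- The restriction of a partially multiplicative functional to the multipliers is a character. -/
theorem IsNormalizedAt.exists_character (hx₀ : IsNormalizedAt H x₀) {τ : StrongDual ℂ H}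
    (hτ : IsPartiallyMultiplicative τ) : ∃ ρ : Character H, Extends τ ρ := by
  obtain ⟨h0, hmul⟩ := hτ
  obtain ⟨f, hf⟩ : ∃ f, τ f ≠ 0 := by
    by_contra! h
    exact h0 (ContinuousLinearMap.ext h)
  have h1 : τ (multToFun x₀ 1) = 1 := by
    have := hmul f (multToFun x₀ 1) f fun x ↦ by
      rw [hx₀.multToFun_apply]
      exact (mul_one _).symm
    exact mul_left_cancel₀ hf (by rw [← this, mul_one])
  refine ⟨AlgHom.ofLinearMap (τ.toLinearMap ∘ₗ multToFun x₀) h1 fun φ ψ ↦ ?_,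
    hx₀.extends_iff.2 fun φ ↦ rfl⟩
  refine hmul _ _ _ fun x ↦ ?_
  rw [hx₀.multToFun_apply, hx₀.multToFun_apply, hx₀.multToFun_apply]
  rfl

theorem IsNormalizedAt.isPartiallyMultiplicative_eval (hx₀ : IsNormalizedAt H x₀) (x : X) :
    IsPartiallyMultiplicative (innerSL ℂ (kfun H x)) ∧
      Extends (innerSL ℂ (kfun H x)) (evalChar H x) := by
  refine ⟨⟨fun h ↦ ?_, fun f g h hfg ↦ ?_⟩, hx₀.extends_iff.2 fun φ ↦ ?_⟩
  · have h1 : innerSL ℂ (kfun H x) (kfun H x₀) = 1 := by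
      rw [innerSL_apply_apply, inner_kfun, hx₀.kfun_apply]
    rw [h] at h1
    exact zero_ne_one h1
  · simp only [innerSL_apply_apply, inner_kfun, hfg]
  · rw [innerSL_apply_apply, inner_kfun, hx₀.multToFun_apply]
    rfl

end Characters

end PickSpace

end

theorem proposition1p4 {X : Type*} {H : Type*} [NormedAddCommGroup H] [InnerProductSpace ℂ H]
    [CompleteSpace H] [RKHS ℂ H X ℂ] (hPick : PickSpace.IsCompletePick H)
    (x₀ : X) (hx₀ : PickSpace.IsNormalizedAt H x₀) :
    (∀ ρ : PickSpace.Character H,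
      List.TFAE [
        ∃ τ : StrongDual ℂ H, PickSpace.IsPartiallyMultiplicative τ ∧ PickSpace.Extends τ ρ,
        PickSpace.IsWeakStarContinuous ρ,
        ρ ∈ PickSpace.gleasonPart (PickSpace.evalChar H x₀)]) ∧
    List.TFAE [
      PickSpace.IsMaximalDomain H,
      ∀ ρ : PickSpace.Character H, PickSpace.IsWeakStarContinuous ρ →
        ∃ x : X, ρ = PickSpace.evalChar H x,
      PickSpace.IsGleasonPart (Set.range (PickSpace.evalChar H))] := by
  have hchar : ∀ ρ : PickSpace.Character H, List.TFAE [
      ∃ τ : StrongDual ℂ H, PickSpace.IsPartiallyMultiplicative τ ∧ PickSpace.Extends τ ρ,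
      PickSpace.IsWeakStarContinuous ρ,
      ρ ∈ PickSpace.gleasonPart (PickSpace.evalChar H x₀)] := by
    intro ρ
    tfae_have 1 → 2 := fun ⟨τ, _, hτ⟩ ↦ hx₀.isWeakStarContinuous_of_extends hτ
    tfae_have 2 → 3 := fun h ↦ hPick.mem_gleasonPart hx₀ h x₀
    tfae_have 3 → 1 := fun h ↦ by
      obtain ⟨r, hr, hρ⟩ := hx₀.exists_lt_one h
      exact hPick.exists_extension hx₀ hr hρ
    tfae_finish
  refine ⟨hchar, ?_⟩
  have heval (x : X) : PickSpace.IsWeakStarContinuous (PickSpace.evalChar H x) :=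
    hx₀.isWeakStarContinuous_of_extends (hx₀.isPartiallyMultiplicative_eval x).2
  tfae_have 1 → 2 := by
    intro h ρ hρ
    obtain ⟨τ, hτ, hτρ⟩ := ((hchar ρ).out 1 0).1 hρ
    obtain ⟨x, hx⟩ := h τ hτ
    refine ⟨x, AlgHom.ext fun φ ↦ ?_⟩
    rw [← hx₀.extends_iff.1 hτρ, hx, hx₀.multToFun_apply, PickSpace.evalChar_apply]
  tfae_have 2 → 3 := by
    intro h
    refine ⟨PickSpace.evalChar H x₀, Set.Subset.antisymm ?_ fun ρ hρ ↦ ?_⟩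
    · rintro _ ⟨x, rfl⟩
      exact hPick.mem_gleasonPart hx₀ (heval x) x₀
    · obtain ⟨x, hx⟩ := h ρ (((hchar ρ).out 2 1).1 hρ)
      exact ⟨x, hx.symm⟩
  -- A Gleason part contains its centre, so the centre is some `δ_x`, not necessarily `δ_{x₀}`. The
  -- restriction of `τ` to multipliers is weak-* continuous, hence lies in the part of `δ_x` and is
  -- some `δ_y`; density of multipliers identifies `τ` with evaluation at `y` on all of `H`.
  tfae_have 3 → 1 := by
    rintro ⟨σ, hσ⟩ τ hτ
    have hσσ : σ ∈ PickSpace.gleasonPart σ := by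
      have : PickSpace.charDist σ σ = 0 := by simp [PickSpace.charDist]
      change PickSpace.charDist σ σ < 2
      rw [this]
      norm_num
    rw [← hσ] at hσσ
    obtain ⟨x, rfl⟩ := hσσ
    obtain ⟨ρ, hρ⟩ := hx₀.exists_character hτ
    have h1 := hPick.mem_gleasonPart hx₀ (hx₀.isWeakStarContinuous_of_extends hρ) x
    rw [← hσ] at h1
    obtain ⟨y, rfl⟩ := h1
    refine ⟨y, fun f ↦ ?_⟩
    refine (hPick.denseRange_mult hx₀).induction (P := fun f : H ↦ τ f = f y) ?_
      (isClosed_eq τ.continuous (RKHS.continuous_eval y)) f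
    rintro _ ⟨φ, rfl⟩
    exact (hx₀.extends_iff.1 hρ φ).trans (hx₀.multToFun_apply φ y).symm
  tfae_finish
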